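/- Let $q$ be a prime power, $n\ge 1$, let $k$ be a finite field of cardinality $q^n$, $k'\subseteq k$ its subfield of cardinality $q$, and $\alpha_0,\dots,\alpha_{n-1}$ a basis of $k$ over $k'$. *Last fall degree.* For a field $K$, a set $\mathcal E\subset S=K[X_0,\dots,X_{n-1}]$ and $i\in\mathbb Z_{\ge 0}$, let $V_{\mathcal E,i}$ be the smallest $K$-vector subspace of $S$ that contains every $f\in\mathcal E$ with $\deg f\le i$ and that contains $gh$ whenever $g\in V_{\mathcal E,i}$, $h\in S$ and $\deg(gh)\le i$; let $V_{\mathcal E,\infty}=\bigcup_i V_{\mathcal E,i}$. The last fall degree $d_{\mathcal E}$ is the minimal $d\in\mathbb Z_{\ge 0}\cup\{\infty\}$ such that $f\in V_{\mathcal E,\max\{d,\deg f\}}$ for all $f$ in the ideal generated by $\mathcal E$. *Weil descent.* For $f\in k[X]$ let $[f]_0,\dots,[f]_{n-1}\in k'[X_0,\dots,X_{n-1}]$ be the unique polynomials of degree at most $q-1$ in every variable such that $$f\Big(\sum_{j}\alpha_jX_j\Big)\equiv\sum_{j}\alpha_j[f]_j \pmod{(X_0^q-X_0,\dots,X_{n-1}^q-X_{n-1})}.$$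 For $\mathcal F\subset k[X]$ put $$\mathcal F'_f=\{[f]_j : f\in\mathcal F,\ 0\le j<n\}\cup\{X_j^q-X_j : 0\le j<n\}\subset k'[X_0,\dots,X_{n-1}].$$ *Fake Weil descent.* For $e\ge 0$ let $e'$ be such that $X^{e'}$ is the remainder of $X^e$ modulo $X^{q^n}-X$, write $e'=\sum_{j=0}^{n-1}e'_jq^j$ with $0\le e'_j\le q-1$, and put $\overline{X^e}=X_0^{e'_0}\cdots X_{n-1}^{e'_{n-1}}\in k[X_0,\dots,X_{n-1}]$. Extend $k$-linearly to a map $f\mapsto\bar f$ on $k[X]$. **Theorem.** Let $\mathcal F\subset k[X]\setminus k$ be finite and nonempty. Let $d$ be the smallest positive integer such that $\deg f\le d$ for some $f\in\mathcal F$ and $\deg\bar f\le (q-1)\lceil\log_q(d)+1\rceil+1$ for all $f\in\mathcal F$. Then $$d_{\mathcal F'_f}\le (q-1)\lceil\log_q(d)+1\rceil+1 .$$ -/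

import Mathlib

open Polynomial

namespace WeilDescent

section FallDegree

variable {σ K : Type*} [Field K]

/-- `V_{E,i}`: the smallest `K`-linear subspace of `K[X_σ]` which contains the elements of `E` of
degree at most `i` and which contains `g * h` whenever it contains `g` and `deg (g * h) ≤ i`. -/
noncomputable def fallSpace (E : Set (MvPolynomial σ K)) (i : ℕ) : Submodule K (MvPolynomial σ K) :=
  sInf {W | (∀ f ∈ E, f.totalDegree ≤ i → f ∈ W) ∧
    ∀ g ∈ W, ∀ h : MvPolynomial σ K, (g * h).totalDegree ≤ i → g * h ∈ W}

/-- `V_{E,i}` for `i ∈ ℕ ∪ {∞}`, where `V_{E,∞}` is the union of all `V_{E,i}`, `i ∈ ℕ`. -/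
def fallSet (E : Set (MvPolynomial σ K)) : ℕ∞ → Set (MvPolynomial σ K)
  | ⊤ => ⋃ i : ℕ, (fallSpace E i : Set (MvPolynomial σ K))
  | (i : ℕ) => (fallSpace E i : Set (MvPolynomial σ K))

/-- The last fall degree of `E`: the minimal `d ∈ ℕ ∪ {∞}` such that every element `f` of the ideal
generated by `E` lies in `V_{E, max (d, deg f)}`. -/
noncomputable def lastFallDegree (E : Set (MvPolynomial σ K)) : ℕ∞ :=
  sInf {d : ℕ∞ | ∀ f ∈ Ideal.span E, f ∈ fallSet E (max d (f.totalDegree : ℕ∞))}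

end FallDegree

/-- The exponent `e'` with `X ^ e' = X ^ e mod (X ^ m - X)`. -/
def redExp (m e : ℕ) : ℕ := if e = 0 then 0 else (e - 1) % (m - 1) + 1

theorem redExp_lt {m : ℕ} (hm : 2 ≤ m) (e : ℕ) : redExp m e < m := by
  unfold redExp
  split_ifs
  · omega
  · have := Nat.mod_lt (e - 1) (show 0 < m - 1 by omega)
    omega

theorem pow_redExp {M : Type*} [Monoid M] {m : ℕ} (hm : 2 ≤ m) {x : M} (hx : x ^ m = x) (e : ℕ) :
    x ^ redExp m e = x ^ e := by
  have key : ∀ t r : ℕ, x ^ ((m - 1) * t + r + 1) = x ^ (r + 1) := by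
    intro t r
    induction t with
    | zero => simp
    | succ t ih =>
      have h1 : (m - 1) * (t + 1) + r + 1 = ((m - 1) * t + r) + m := by
        rw [Nat.mul_succ]; omega
      rw [h1, pow_add, hx, ← pow_succ, ih]
  unfold redExp
  split_ifs with h
  · rw [h]
  · have h2 : (m - 1) * ((e - 1) / (m - 1)) + (e - 1) % (m - 1) + 1 = e := by
      rw [Nat.div_add_mod]; omega
    rw [← key ((e - 1) / (m - 1)) ((e - 1) % (m - 1)), h2]

theorem X_pow_mod {k : Type*} [Field k] {m : ℕ} (hm : 2 ≤ m) (e : ℕ) :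
    (X ^ e : k[X]) %ₘ (X ^ m - X) = X ^ redExp m e := by
  have hdeg : (X : k[X]).degree < (m : WithBot ℕ) := by
    rw [degree_X]; exact_mod_cast hm
  have hmon : (X ^ m - X : k[X]).Monic := monic_X_pow_sub (by
    rw [degree_X]; exact_mod_cast hm)
  have hd : (X ^ e : k[X]) - X ^ redExp m e ∈ Ideal.span {(X ^ m - X : k[X])} := by
    rw [← Ideal.Quotient.eq, map_pow, map_pow]
    refine (pow_redExp hm ?_ e).symm
    rw [← map_pow, Ideal.Quotient.eq]
    exact Ideal.subset_span rfl
  obtain ⟨c, hc⟩ := Ideal.mem_span_singleton.mp hd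
  refine (div_modByMonic_unique c _ hmon ⟨?_, ?_⟩).2
  · rw [← hc]; ring
  · rw [degree_sub_eq_left_of_degree_lt (by simpa using hdeg), degree_X_pow, degree_X_pow]
    exact_mod_cast redExp_lt hm e

/-- The fake Weil descent `f ↦ f̄`, `k[X] → k[X_0, …, X_{n-1}]`: it is `k`-linear, and it sends
`X ^ e` to `∏ j, X_j ^ e'_j`, where `X ^ e' = X ^ e mod (X ^ (q ^ n) - X)` and
`e' = ∑ j, e'_j * q ^ j` is the expansion of `e'` in base `q`. -/
noncomputable def fakeDescent {k : Type*} [Field k] (q n : ℕ) (f : k[X]) :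
    MvPolynomial (Fin n) k :=
  f.sum fun e a =>
    MvPolynomial.C a * ∏ j : Fin n, MvPolynomial.X j ^ (redExp (q ^ n) e / q ^ (j : ℕ) % q)

section Descent

variable {k' k : Type*} [Field k'] [Field k] [Algebra k' k] {n : ℕ}

/-- The family `g` consists of the components `[f]_j` of `f` with respect to the basis `α` of
`k / k'`, where `k'` has `q` elements: every `g j` has coefficients in `k'` and degree at most
`q - 1` in every variable, and `f (∑ j, α_j X_j) ≡ ∑ j, α_j [f]_j` modulo all `X_j ^ q - X_j`. -/
def IsWeilComponents (α : Module.Basis (Fin n) k' k) (f : k[X])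
    (g : Fin n → MvPolynomial (Fin n) k') : Prop :=
  (∀ j i, (g j).degreeOf i ≤ Nat.card k' - 1) ∧
    Polynomial.aeval (∑ j, MvPolynomial.C (α j) * MvPolynomial.X j : MvPolynomial (Fin n) k) f
        - ∑ j, MvPolynomial.C (α j) * MvPolynomial.map (algebraMap k' k) (g j) ∈
      Ideal.span (Set.range fun j : Fin n =>
        (MvPolynomial.X j ^ Nat.card k' - MvPolynomial.X j : MvPolynomial (Fin n) k))

theorem exists_components [Finite k'] (α : Module.Basis (Fin n) k' k)
    (P : MvPolynomial (Fin n) k) : ∃ g : Fin n → MvPolynomial (Fin n) k',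
      (∀ j i, (g j).degreeOf i ≤ Nat.card k' - 1) ∧
      P - ∑ j, MvPolynomial.C (α j) * MvPolynomial.map (algebraMap k' k) (g j) ∈
      Ideal.span (Set.range fun j : Fin n =>
        (MvPolynomial.X j ^ Nat.card k' - MvPolynomial.X j : MvPolynomial (Fin n) k)) := by
  have hq : 2 ≤ Nat.card k' := Finite.one_lt_card
  induction P using MvPolynomial.induction_on' with
  | monomial e a =>
    let r : Fin n →₀ ℕ := Finsupp.equivFunOnFinite.symm fun i => redExp (Nat.card k') (e i)
    refine ⟨fun j => MvPolynomial.monomial r (α.repr a j), fun j i => ?_, ?_⟩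
    · by_cases h : α.repr a j = 0
      · simp [h]
      · rw [MvPolynomial.degreeOf_monomial_eq _ _ h]
        have := redExp_lt hq (e i)
        simp only [r, Finsupp.equivFunOnFinite_symm_apply_apply]
        omega
    · have h1 : ∑ j, MvPolynomial.C (α j) * MvPolynomial.map (algebraMap k' k)
          (MvPolynomial.monomial r (α.repr a j)) = MvPolynomial.monomial r a := by
        simp only [MvPolynomial.map_monomial, MvPolynomial.C_mul_monomial]
        rw [← map_sum]
        congr 1
        conv_rhs => rw [← α.sum_repr a]
        exact Finset.sum_congr rfl fun j _ => by rw [Algebra.smul_def, mul_comm]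
      rw [h1, ← Ideal.Quotient.eq, MvPolynomial.monomial_eq, MvPolynomial.monomial_eq,
        map_mul, map_mul]
      congr 1
      rw [Finsupp.prod_fintype _ _ (by simp), Finsupp.prod_fintype _ _ (by simp), map_prod,
        map_prod]
      refine Finset.prod_congr rfl fun i _ => ?_
      rw [map_pow, map_pow]
      refine (pow_redExp hq ?_ (e i)).symm
      rw [← map_pow, Ideal.Quotient.eq]
      exact Ideal.subset_span ⟨i, rfl⟩
  | add p p' hp hp' =>
    obtain ⟨g, hg, hgm⟩ := hp
    obtain ⟨g', hg', hgm'⟩ := hp'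
    refine ⟨g + g', fun j i => ?_, ?_⟩
    · exact (MvPolynomial.degreeOf_add_le i _ _).trans (max_le (hg j i) (hg' j i))
    · have := Ideal.add_mem _ hgm hgm'
      convert this using 1
      simp only [Pi.add_apply, map_add, mul_add, Finset.sum_add_distrib]
      ring

theorem components_eq_zero [Finite k'] (α : Module.Basis (Fin n) k' k)
    (g : Fin n → MvPolynomial (Fin n) k')
    (hg : ∀ j i, (g j).degreeOf i ≤ Nat.card k' - 1)
    (h : ∑ j, MvPolynomial.C (α j) * MvPolynomial.map (algebraMap k' k) (g j) ∈
      Ideal.span (Set.range fun j : Fin n =>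
        (MvPolynomial.X j ^ Nat.card k' - MvPolynomial.X j : MvPolynomial (Fin n) k))) (j : Fin n) :
    g j = 0 := by
  classical
  have := Fintype.ofFinite k'
  have hq : 2 ≤ Nat.card k' := Finite.one_lt_card
  have hev : ∀ x : Fin n → k', ∀ j, MvPolynomial.eval x (g j) = 0 := by
    intro x
    have h0 : MvPolynomial.eval (fun i => algebraMap k' k (x i))
        (∑ j, MvPolynomial.C (α j) * MvPolynomial.map (algebraMap k' k) (g j)) = 0 := by
      rw [← RingHom.mem_ker]
      refine (Ideal.span_le.mpr ?_) h
      rintro _ ⟨i, rfl⟩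
      simp only [SetLike.mem_coe, RingHom.mem_ker, map_sub, map_pow, MvPolynomial.eval_X]
      rw [← map_pow, Nat.card_eq_fintype_card, FiniteField.pow_card, sub_self]
    have h1 : ∑ j, (MvPolynomial.eval x (g j)) • α j = 0 := by
      rw [← h0, map_sum]
      refine Finset.sum_congr rfl fun j _ => ?_
      rw [map_mul, MvPolynomial.eval_C, MvPolynomial.eval_map, Algebra.smul_def, mul_comm,
        MvPolynomial.eval, MvPolynomial.coe_eval₂Hom, MvPolynomial.hom_eval₂]
      rfl
    exact fun j => Fintype.linearIndependent_iff.mp α.linearIndependent _ h1 j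
  refine MvPolynomial.eq_zero_of_eval_zero_at_prod_finset (g j) (fun _ => Finset.univ) ?_ ?_
  · intro i
    have := hg j i
    rw [Finset.card_univ, ← Nat.card_eq_fintype_card]
    omega
  · intro x _
    exact hev x j

theorem existsUnique_isWeilComponents [Finite k'] (α : Module.Basis (Fin n) k' k) (f : k[X]) :
    ∃! g : Fin n → MvPolynomial (Fin n) k', IsWeilComponents α f g := by
  obtain ⟨g, hg, hgm⟩ := exists_components α
    (Polynomial.aeval (∑ j, MvPolynomial.C (α j) * MvPolynomial.X j : MvPolynomial (Fin n) k) f)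
  refine ⟨g, ⟨hg, hgm⟩, fun g' hg' => ?_⟩
  funext j
  rw [← sub_eq_zero]
  refine components_eq_zero α (fun j => g' j - g j) (fun j i => ?_) ?_ j
  · exact (MvPolynomial.degreeOf_sub_le i _ _).trans (max_le (hg'.1 j i) (hg j i))
  · have := Ideal.sub_mem _ hgm hg'.2
    convert this using 1
    simp only [map_sub, mul_sub, Finset.sum_sub_distrib]
    ring

/-- The component `[f]_j ∈ k'[X_0, …, X_{n-1}]` of `f` with respect to the basis `α`. -/
noncomputable def weilComponent [Finite k'] (α : Module.Basis (Fin n) k' k) (f : k[X])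
    (j : Fin n) : MvPolynomial (Fin n) k' :=
  (existsUnique_isWeilComponents α f).choose j

theorem weilComponent_spec [Finite k'] (α : Module.Basis (Fin n) k' k) (f : k[X]) :
    IsWeilComponents α f (weilComponent α f) :=
  (existsUnique_isWeilComponents α f).choose_spec.1

/-- The Weil descent system with field equations: all `[f]_j` with `f ∈ F`, and all
`X_j ^ q - X_j`, where `q` is the cardinality of `k'`. -/
def weilSystemField [Finite k'] (α : Module.Basis (Fin n) k' k) (F : Set k[X]) :
    Set (MvPolynomial (Fin n) k') :=
  {g | ∃ f ∈ F, ∃ j, g = weilComponent α f j} ∪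
    Set.range fun j : Fin n => MvPolynomial.X j ^ Nat.card k' - MvPolynomial.X j

end Descent

/-- The number `(q - 1) ⌈log_q d + 1⌉ + 1`. -/
noncomputable def fallBound (q d : ℕ) : ℕ := (q - 1) * ⌈Real.logb q d + 1⌉₊ + 1

end WeilDescent

/-!
The bound is proved over `k`, where the Weil descent becomes the fake one. Put
`Y_j = ∑ i, α_i ^ (q ^ j) X_i`. Modulo the field equations `Y_j ^ q = Y_{j+1}` with cyclic indices,
and `∑ j, α_j [f]_j` is congruent to the fake Weil descent `f̄` evaluated at the `Y_j`
(`conjDescent`). Reducing by the field equations does not raise degrees, so this congruence holds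
inside the fall space (`IsFrobeniusFallSpace.sub_fieldReduce_mem`), and `deg [f]_j ≤ deg f̄`.

Fix a degree `D ≥ fallBound q d`, and let `W` be the extension of scalars to `k` of the fall space
of degree `D`. Since the system is defined over `k'`, the Frobenius on coefficients, which sends
`Y_j` to `Y_{j+1}`, preserves `W`. Choose `f₀ ≠ 0` of least degree with `f̄₀ ∈ W`. The hypothesis on
`d` gives `deg f₀ ≤ d ≤ q ^ c`, where `fallBound q d = (q - 1) (c + 1) + 1`, while polynomials of
degree below `q ^ (c + 1)` have fake descent of degree at most `(q - 1) (c + 1) < D`, so that there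
is room for one multiplication by `Y_0`, i.e. by `X`. Hence `h̄` is congruent modulo `W` to the
descent of `h` reduced modulo `f₀` whenever `deg h ≤ q ^ (c + 1)`
(`IsMinimalDescent.conjDescent_sub_mod_mem`). Multiplication by `Y_j` is conjugate to that by `Y_0`
under a power of the Frobenius, and corresponds to multiplication by `X ^ (q ^ j)` modulo `f₀`
(`IsMinimalDescent.conjForm_mul_sub_mem`). Every `X_i` is a linear combination of the `Y_j`, by the
trace dual basis, so every `P` of degree at most `D` is congruent modulo `W` to the descent of the
remainder modulo `f₀` of the univariate polynomial `Φ(P)` obtained from `Y_j ↦ X ^ (q ^ j)`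
(`IsMinimalDescent.sub_conjDescent_mem`).

For a member `v` of the system, which lies in `W`, minimality of `f₀` forces `f₀ ∣ Φ(v)`. So
`f₀ ∣ Φ(g)` for every `g` in the ideal, and if `deg g ≤ D` the congruence reads `g ∈ W`. Being
defined over `k'`, such a `g` lies in the fall space of degree `D` itself.
-/

namespace WeilDescent

/-! ### Base `q` digits of exponents -/

/-- The base `q` digits of the exponent `e'` with `X ^ e' = X ^ e mod (X ^ (q ^ n) - X)`. -/
def expDigit (q n e : ℕ) (j : Fin n) : ℕ := redExp (q ^ n) e / q ^ (j : ℕ) % q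

/-- The exponent `∑ j, m_j * q ^ j` which the digit vector `m` stands for; the digits may exceed
`q - 1`. -/
def digitValue (q : ℕ) {n : ℕ} (m : Fin n → ℕ) : ℕ := ∑ j, m j * q ^ (j : ℕ)

theorem redExp_zero (m : ℕ) : redExp m 0 = 0 := rfl

theorem redExp_congr {m e e' : ℕ} (h : e ≡ e' [MOD m - 1]) (h0 : e = 0 ↔ e' = 0) :
    redExp m e = redExp m e' := by
  unfold redExp
  by_cases he : e = 0
  · rw [if_pos he, if_pos (h0.mp he)]
  · have he' : e' ≠ 0 := fun h => he (h0.mpr h)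
    rw [if_neg he, if_neg he']
    have : e - 1 ≡ e' - 1 [MOD m - 1] := by
      apply Nat.ModEq.add_right_cancel' 1
      rwa [Nat.sub_add_cancel (by omega), Nat.sub_add_cancel (by omega)]
    rw [this]

theorem redExp_eq_self {m e : ℕ} (h : e < m) : redExp m e = e := by
  unfold redExp
  split_ifs with h0
  · exact h0.symm
  · rw [Nat.mod_eq_of_lt (by omega)]; omega

theorem redExp_le (m e : ℕ) : redExp m e ≤ e := by
  unfold redExp
  split_ifs with h0
  · exact Nat.zero_le _
  · have := Nat.mod_le (e - 1) (m - 1)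
    omega

theorem redExp_modEq (m e : ℕ) : redExp m e ≡ e [MOD m - 1] := by
  unfold redExp
  split_ifs with h0
  · rw [h0]
  · have h := (Nat.mod_modEq (e - 1) (m - 1)).add_right 1
    rwa [Nat.sub_add_cancel (by omega)] at h

theorem redExp_eq_zero {m e : ℕ} : redExp m e = 0 ↔ e = 0 := by
  unfold redExp
  split_ifs with h0 <;> simp [h0]

theorem sum_digits_eq_mod (q x n : ℕ) :
    ∑ j : Fin n, x / q ^ (j : ℕ) % q * q ^ (j : ℕ) = x % q ^ n := by
  induction n with
  | zero => simp [Nat.mod_one]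
  | succ n ih =>
    rw [Fin.sum_univ_castSucc, Nat.mod_pow_succ]
    simp only [Fin.val_castSucc, Fin.val_last]
    rw [ih, mul_comm]

theorem digitValue_expDigit {q n : ℕ} (h : 2 ≤ q ^ n) (e : ℕ) :
    digitValue q (expDigit q n e) = redExp (q ^ n) e := by
  unfold digitValue expDigit
  rw [sum_digits_eq_mod, Nat.mod_eq_of_lt (redExp_lt h e)]

theorem expDigit_digitValue {q n : ℕ} {m : Fin n → ℕ} (hm : ∀ j, m j < q) :
    expDigit q n (digitValue q m) = m := by
  have h1 := (finFunctionFinEquiv (m := q) (n := n)).symm_apply_apply fun j => ⟨m j, hm j⟩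
  have h2 := ((finFunctionFinEquiv (m := q) (n := n)) fun j => ⟨m j, hm j⟩).2
  funext j
  have h3 := congrArg Fin.val (congrFun h1 j)
  simp only [finFunctionFinEquiv_apply, finFunctionFinEquiv_symm_apply_val] at h2 h3
  unfold expDigit
  rw [redExp_eq_self (show digitValue q m < q ^ n from h2)]
  exact h3

theorem expDigit_congr {q n e e' : ℕ} (h : redExp (q ^ n) e = redExp (q ^ n) e') :
    expDigit q n e = expDigit q n e' := by
  funext j; simp only [expDigit, h]

theorem sum_expDigit_le {q n c e : ℕ} (hq : 2 ≤ q) (he : e < q ^ c) :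
    ∑ j, expDigit q n e j ≤ (q - 1) * c := by
  have hlt : ∀ j : Fin n, expDigit q n e j ≤ if (j : ℕ) < c then q - 1 else 0 := by
    intro j
    unfold expDigit
    split_ifs with h
    · have := Nat.mod_lt (redExp (q ^ n) e / q ^ (j : ℕ)) (show 0 < q by omega)
      omega
    · rw [Nat.div_eq_of_lt, Nat.zero_mod]
      exact (redExp_le _ _).trans_lt (he.trans_le (Nat.pow_le_pow_right (by omega) (by omega)))
  refine (Finset.sum_le_sum fun j _ => hlt j).trans ?_
  rw [← Finset.sum_filter, Finset.sum_const, smul_eq_mul, mul_comm]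
  refine Nat.mul_le_mul_left _ ?_
  have : (Finset.univ.filter fun j : Fin n => (j : ℕ) < c).card ≤ (Finset.range c).card :=
    Finset.card_le_card_of_injOn Fin.val (fun j hj => by simpa using hj)
      Fin.val_injective.injOn
  simpa using this

theorem digitValue_add (q : ℕ) {n : ℕ} (a b : Fin n → ℕ) :
    digitValue q (a + b) = digitValue q a + digitValue q b := by
  simp [digitValue, add_mul, Finset.sum_add_distrib]

theorem digitValue_single (q : ℕ) {n : ℕ} (j : Fin n) (a : ℕ) :
    digitValue q (Pi.single j a) = a * q ^ (j : ℕ) := by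
  simp [digitValue, Pi.single_apply, ite_mul]

theorem digitValue_eq_zero {q n : ℕ} (hq : 2 ≤ q) {m : Fin n → ℕ} :
    digitValue q m = 0 ↔ m = 0 := by
  have : q ≠ 0 := by omega
  simp [digitValue, this, funext_iff]

theorem pow_succ_mod_modEq {q n j : ℕ} (hq : 2 ≤ q) (hj : j < n) :
    q ^ ((j + 1) % n) ≡ q ^ (j + 1) [MOD q ^ n - 1] := by
  rcases Nat.lt_or_ge (j + 1) n with h | h
  · rw [Nat.mod_eq_of_lt h]
  · obtain rfl : n = j + 1 := by omega
    rw [Nat.mod_self, pow_zero]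
    exact (Nat.modEq_iff_dvd' (Nat.one_le_pow _ _ (by omega))).mpr dvd_rfl

/-! ### The conjugate linear forms -/

section Core

variable {k : Type*} [Field k] {q n : ℕ}

/-- The linear form `Y_j = ∑ i, α_i ^ (q ^ j) * X_i`, the `j`-th Frobenius conjugate of
`∑ i, α_i * X_i`. The index `j` runs over all of `ℕ`. -/
noncomputable def conjForm (q : ℕ) (α : Fin n → k) (j : ℕ) : MvPolynomial (Fin n) k :=
  ∑ i, MvPolynomial.C (α i ^ q ^ j) * MvPolynomial.X i

/-- The monomial `∏ j, Y_j ^ m_j` in the conjugate linear forms. -/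
noncomputable def conjMonomial (q : ℕ) (α : Fin n → k) (m : Fin n → ℕ) :
    MvPolynomial (Fin n) k :=
  ∏ j : Fin n, conjForm q α j ^ m j

/-- The fake Weil descent of `f`, evaluated at the conjugate linear forms. -/
noncomputable def conjDescent (q : ℕ) (α : Fin n → k) : k[X] →ₗ[k] MvPolynomial (Fin n) k :=
  Polynomial.lsum fun e =>
    LinearMap.toSpanSingleton k (MvPolynomial (Fin n) k) (conjMonomial q α (expDigit q n e))

theorem conjDescent_monomial (α : Fin n → k) (e : ℕ) (a : k) :
    conjDescent q α (monomial e a) = a • conjMonomial q α (expDigit q n e) := by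
  simp [conjDescent]

theorem conjDescent_eq_aeval_fakeDescent (α : Fin n → k) (f : k[X]) :
    conjDescent q α f =
      MvPolynomial.aeval (fun j : Fin n => conjForm q α j) (fakeDescent q n f) := by
  rw [fakeDescent, Polynomial.sum, map_sum, conjDescent, Polynomial.lsum_apply, Polynomial.sum]
  refine Finset.sum_congr rfl fun e _ => ?_
  simp [conjMonomial, expDigit, MvPolynomial.smul_eq_C_mul]

theorem totalDegree_conjForm_le (α : Fin n → k) (j : ℕ) : (conjForm q α j).totalDegree ≤ 1 := by
  refine MvPolynomial.totalDegree_finsetSum_le fun i _ => ?_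
  refine (MvPolynomial.totalDegree_mul _ _).trans ?_
  rw [MvPolynomial.totalDegree_C, MvPolynomial.totalDegree_X]

theorem totalDegree_conjMonomial_le (α : Fin n → k) (m : Fin n → ℕ) :
    (conjMonomial q α m).totalDegree ≤ ∑ j, m j := by
  refine (MvPolynomial.totalDegree_finsetProd _ _).trans (Finset.sum_le_sum fun j _ => ?_)
  refine (MvPolynomial.totalDegree_pow _ _).trans ?_
  exact (Nat.mul_le_mul_left _ (totalDegree_conjForm_le α j)).trans (by simp)

theorem conjMonomial_add (α : Fin n → k) (a b : Fin n → ℕ) :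
    conjMonomial q α (a + b) = conjMonomial q α a * conjMonomial q α b := by
  simp [conjMonomial, pow_add, Finset.prod_mul_distrib]

theorem conjMonomial_single (α : Fin n → k) (j : Fin n) (a : ℕ) :
    conjMonomial q α (Pi.single j a) = conjForm q α j ^ a := by
  rw [conjMonomial, Finset.prod_eq_single j]
  · simp
  · intro i _ hi; simp [hi]
  · simp

theorem conjForm_add_period {α : Fin n → k} (hk : ∀ a : k, a ^ q ^ n = a) (j : ℕ) :
    conjForm q α (j + n) = conjForm q α j := by
  simp only [conjForm, pow_add, pow_mul, hk]

theorem conjForm_mod {α : Fin n → k} (hk : ∀ a : k, a ^ q ^ n = a) (j : ℕ) :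
    conjForm q α (j % n) = conjForm q α j :=
  Function.Periodic.map_mod_nat (conjForm_add_period hk) j

theorem map_conjForm {τ : k →+* k} (hτ : ∀ a, τ a = a ^ q) (α : Fin n → k) (j : ℕ) :
    MvPolynomial.map τ (conjForm q α j) = conjForm q α (j + 1) := by
  simp [conjForm, hτ, pow_succ, pow_mul, pow_right_comm _ q]

/-- The fake Weil descent of `f` has low degree as soon as `deg f < q ^ c`, because the exponents
of `f` have at most `c` digits in base `q`. -/
theorem totalDegree_conjDescent_le {α : Fin n → k} (hq : 2 ≤ q) {c : ℕ} {f : k[X]}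
    (hf : f.natDegree < q ^ c) : (conjDescent q α f).totalDegree ≤ (q - 1) * c := by
  rw [f.as_sum_range' _ hf, map_sum]
  refine MvPolynomial.totalDegree_finsetSum_le fun e he => ?_
  rw [conjDescent_monomial]
  refine (MvPolynomial.totalDegree_smul_le _ _).trans ((totalDegree_conjMonomial_le _ _).trans ?_)
  exact sum_expDigit_le hq (Finset.mem_range.mp he)

/-! ### Congruences modulo a Frobenius stable fall space -/

/-- The ring endomorphism `τ` of `k` is the `q`-power Frobenius for a power `q` of the
characteristic, and `τ ^ n` is the identity. -/
structure IsPowFrobenius (τ : k →+* k) (q n : ℕ) : Prop where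
  exists_expChar : ∃ p r : ℕ, ∃ _ : ExpChar k p, q = p ^ r
  two_le : 2 ≤ q
  pos : 0 < n
  apply_eq : ∀ a, τ a = a ^ q
  pow_card : ∀ a : k, a ^ q ^ n = a

/-- The properties of the fall space of degree `D` over `k` on which the argument rests: `W` is
closed under multiplications which stay within degree `D`, it is stable under the map induced by
`τ` (the `q`-power Frobenius) on coefficients, and it contains the field equations. -/
structure IsFrobeniusFallSpace (τ : k →+* k) (q D : ℕ)
    (W : Submodule k (MvPolynomial (Fin n) k)) : Prop where
  mul_mem : ∀ g ∈ W, ∀ h, g.totalDegree + h.totalDegree ≤ D → g * h ∈ W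
  map_mem : ∀ g ∈ W, MvPolynomial.map τ g ∈ W
  field_mem : ∀ i, MvPolynomial.X i ^ q - MvPolynomial.X i ∈ W

variable {τ : k →+* k} {D : ℕ} {W : Submodule k (MvPolynomial (Fin n) k)} {α : Fin n → k}

theorem sub_mem_trans {R M : Type*} [Ring R] [AddCommGroup M] [Module R M]
    {W : Submodule R M} {a b c : M} (h1 : a - b ∈ W) (h2 : b - c ∈ W) : a - c ∈ W := by
  simpa using W.add_mem h1 h2

theorem IsFrobeniusFallSpace.map_sub_mem (hW : IsFrobeniusFallSpace τ q D W)
    {g h : MvPolynomial (Fin n) k} (hgh : g - h ∈ W) :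
    MvPolynomial.map τ g - MvPolynomial.map τ h ∈ W := by
  rw [← map_sub]; exact hW.map_mem _ hgh

/-- Congruent polynomials stay congruent after a multiplication which stays within degree `D`. -/
theorem IsFrobeniusFallSpace.mul_sub_mul_mem (hW : IsFrobeniusFallSpace τ q D W)
    {g h f : MvPolynomial (Fin n) k} (hgh : g - h ∈ W) (hg : f.totalDegree + g.totalDegree ≤ D)
    (hh : f.totalDegree + h.totalDegree ≤ D) : f * g - f * h ∈ W := by
  rw [← mul_sub, mul_comm]
  refine hW.mul_mem _ hgh _ ?_
  have := MvPolynomial.totalDegree_sub g h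
  omega

theorem totalDegree_map_le {σ R S : Type*} [CommSemiring R] [CommSemiring S] (φ : R →+* S)
    (f : MvPolynomial σ R) : (MvPolynomial.map φ f).totalDegree ≤ f.totalDegree :=
  Finset.sup_mono (MvPolynomial.support_map_subset _ _)

/-- `Y_j ^ q ≡ Y_{j+1}`: over `k` the field equations turn into the cyclic relations between the
conjugate forms. -/
theorem conjForm_pow_sub_mem (hF : IsPowFrobenius τ q n)
    (hW : ∀ i, MvPolynomial.X i ^ q - MvPolynomial.X i ∈ W) (j : ℕ) :
    conjForm q α j ^ q - conjForm q α (j + 1) ∈ W := by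
  obtain ⟨p, r, _, hqp⟩ := hF.exists_expChar
  have h : conjForm q α j ^ q - conjForm q α (j + 1) =
      ∑ i, (α i ^ q ^ (j + 1)) • (MvPolynomial.X i ^ q - MvPolynomial.X i) := by
    have h1 : conjForm q α j ^ q =
        ∑ i, (MvPolynomial.C (α i ^ q ^ j) * MvPolynomial.X i : MvPolynomial (Fin n) k) ^ q := by
      subst hqp
      simp only [← iterateFrobenius_def, conjForm, map_sum]
    rw [h1, conjForm, ← Finset.sum_sub_distrib]
    refine Finset.sum_congr rfl fun i _ => ?_
    rw [MvPolynomial.smul_eq_C_mul, mul_pow, ← map_pow, ← pow_mul, ← pow_succ, mul_sub]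
  rw [h]
  exact W.sum_mem fun i _ => W.smul_mem _ (hW i)

/-- A monomial of degree at most `D` in the conjugate forms is congruent to the one with reduced
digits: as long as some exponent is at least `q`, a carry `Y_j ^ q ≡ Y_{j+1}` lowers the
degree. -/
theorem conjMonomial_sub_mem (hF : IsPowFrobenius τ q n)
    (hW : IsFrobeniusFallSpace τ q D W) {m : Fin n → ℕ}
    (hm : ∑ j, m j ≤ D) :
    conjMonomial q α m - conjMonomial q α (expDigit q n (digitValue q m)) ∈ W := by
  have hq := hF.two_le
  have hk := hF.pow_card
  obtain ⟨N, hN⟩ : ∃ N, ∑ j, m j = N := ⟨_, rfl⟩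
  induction N using Nat.strong_induction_on generalizing m with
  | _ N ih =>
    by_cases h : ∀ j, m j < q
    · rw [expDigit_digitValue h, sub_self]; exact W.zero_mem
    · push Not at h
      obtain ⟨j, hj⟩ := h
      have hn := hF.pos
      let j' : Fin n := ⟨(j + 1) % n, Nat.mod_lt _ hn⟩
      obtain ⟨m0, rfl⟩ : ∃ m0 : Fin n → ℕ, m = m0 + Pi.single j q := by
        refine ⟨m - Pi.single j q, (tsub_add_cancel_of_le ?_).symm⟩
        intro i
        by_cases hi : i = j
        · subst hi; simpa using hj
        · simp [hi]
      have hs : ∀ (i : Fin n) (a : ℕ),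
          ∑ l, (m0 + Pi.single i a : Fin n → ℕ) l = ∑ l, m0 l + a := by
        intro i a
        simp [Finset.sum_add_distrib]
      rw [hs] at hm hN
      have h1 : conjMonomial q α (m0 + Pi.single j q) - conjMonomial q α (m0 + Pi.single j' 1)
          ∈ W := by
        rw [conjMonomial_add, conjMonomial_add, conjMonomial_single, conjMonomial_single, pow_one]
        have hc : conjForm q α j' = conjForm q α (j + 1) := conjForm_mod hk _
        rw [hc]
        refine hW.mul_sub_mul_mem (conjForm_pow_sub_mem hF hW.field_mem j) ?_ ?_
        · have h2 := MvPolynomial.totalDegree_pow (conjForm q α j) q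
          have h3 := Nat.mul_le_mul_left q (totalDegree_conjForm_le (q := q) α j)
          have h4 := totalDegree_conjMonomial_le (q := q) α m0
          omega
        · have h3 := totalDegree_conjForm_le (q := q) α (j + 1)
          have h4 := totalDegree_conjMonomial_le (q := q) α m0
          omega
      have h2 := @ih (∑ l, m0 l + 1) (by omega) (m0 + Pi.single j' 1)
        (by rw [hs]; omega) (hs _ _)
      have h3 : expDigit q n (digitValue q (m0 + Pi.single j q)) =
          expDigit q n (digitValue q (m0 + Pi.single j' 1)) := by
        refine expDigit_congr (redExp_congr ?_ ?_)
        · rw [digitValue_add, digitValue_add, digitValue_single, digitValue_single, one_mul,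
            ← pow_succ']
          exact (pow_succ_mod_modEq hq j.2).symm.add_left _
        · rw [digitValue_eq_zero hq, digitValue_eq_zero hq]
          constructor
          · intro h0; have := congrFun h0 j; simp at this; omega
          · intro h0; have := congrFun h0 j'; simp at this
      rw [h3]
      exact sub_mem_trans h1 h2

theorem two_le_pow_of_pos (hq : 2 ≤ q) (hn : 0 < n) : 2 ≤ q ^ n :=
  hq.trans (Nat.le_self_pow hn.ne' q)

/-- `Y_0 * f̄ ≡ \overline{X f}` if `deg f < q ^ c` and `(q - 1) * c < D`. -/
theorem conjForm_mul_conjDescent_sub_mem (hF : IsPowFrobenius τ q n)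
    (hW : IsFrobeniusFallSpace τ q D W) {c : ℕ}
    (hc : (q - 1) * c + 1 ≤ D) {f : k[X]} (hf : f.natDegree < q ^ c) :
    conjForm q α 0 * conjDescent q α f - conjDescent q α (X * f) ∈ W := by
  have hq := hF.two_le
  have hn := hF.pos
  rw [f.as_sum_range' _ hf, Finset.mul_sum, map_sum, map_sum, Finset.mul_sum,
    ← Finset.sum_sub_distrib]
  refine W.sum_mem fun e he => ?_
  rw [X_mul_monomial, conjDescent_monomial, conjDescent_monomial, mul_smul_comm, ← smul_sub]
  refine W.smul_mem _ ?_
  have h1 : conjForm q α 0 * conjMonomial q α (expDigit q n e) =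
      conjMonomial q α (expDigit q n e + Pi.single ⟨0, hn⟩ 1) := by
    rw [conjMonomial_add, conjMonomial_single, pow_one, mul_comm]
  have h2 : expDigit q n (e + 1) =
      expDigit q n (digitValue q (expDigit q n e + Pi.single ⟨0, hn⟩ 1)) := by
    rw [digitValue_add, digitValue_single, digitValue_expDigit (two_le_pow_of_pos hq hn)]
    refine expDigit_congr (redExp_congr ?_ (by simp))
    simpa using ((redExp_modEq (q ^ n) e).add_right 1).symm
  rw [h1, h2]
  refine conjMonomial_sub_mem hF hW ?_
  have := sum_expDigit_le (n := n) hq (Finset.mem_range.mp he)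
  simp only [Pi.add_apply, Finset.sum_add_distrib, Finset.sum_pi_single', Finset.mem_univ, if_true]
  simp
  omega

/-- The Frobenius on coefficients turns `f̄` into the fake Weil descent of `f ^ q`, modulo `W`. -/
theorem map_conjDescent_sub_mem (hF : IsPowFrobenius τ q n)
    (hW : IsFrobeniusFallSpace τ q D W) {c : ℕ}
    (hc : (q - 1) * c + 1 ≤ D) {f : k[X]} (hf : f.natDegree < q ^ c) :
    MvPolynomial.map τ (conjDescent q α f) - conjDescent q α (f ^ q) ∈ W := by
  obtain ⟨⟨p, r, _, hqp⟩, hq, hn, hτ, hk⟩ := id hF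
  have hpow : f ^ q = ∑ e ∈ Finset.range (q ^ c), monomial e (f.coeff e) ^ q := by
    conv_lhs => rw [f.as_sum_range' _ hf]
    subst hqp
    simp only [← iterateFrobenius_def, map_sum]
  have hsum : conjDescent q α f =
      ∑ e ∈ Finset.range (q ^ c), conjDescent q α (monomial e (f.coeff e)) := by
    conv_lhs => rw [f.as_sum_range' _ hf]
    rw [map_sum]
  rw [hpow, hsum, map_sum, map_sum, ← Finset.sum_sub_distrib]
  refine W.sum_mem fun e he => ?_
  rw [monomial_pow, conjDescent_monomial, conjDescent_monomial, MvPolynomial.smul_eq_C_mul,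
    map_mul, MvPolynomial.map_C, hτ, ← MvPolynomial.smul_eq_C_mul, ← smul_sub]
  refine W.smul_mem _ ?_
  -- the Frobenius rotates the digits of `e` cyclically
  have hrot : ∀ j : Fin n, ((finRotate n j : Fin n) : ℕ) = (j + 1) % n := by
    intro j
    obtain ⟨m, rfl⟩ : ∃ m, n = m + 1 := ⟨n - 1, by omega⟩
    simp [Fin.val_add]
  let m : Fin n → ℕ := fun j => expDigit q n e ((finRotate n).symm j)
  have h1 : MvPolynomial.map τ (conjMonomial q α (expDigit q n e)) = conjMonomial q α m := by
    rw [conjMonomial, map_prod, conjMonomial]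
    conv_rhs => rw [← Equiv.prod_comp (finRotate n)]
    refine Finset.prod_congr rfl fun j _ => ?_
    rw [map_pow, map_conjForm hτ, hrot, conjForm_mod hk]
    simp only [m, Equiv.symm_apply_apply]
  have h2 : expDigit q n (e * q) = expDigit q n (digitValue q m) := by
    have h3 : digitValue q m ≡ digitValue q (expDigit q n e) * q [MOD q ^ n - 1] := by
      unfold digitValue
      rw [← Equiv.sum_comp (finRotate n), Finset.sum_mul]
      refine Nat.ModEq.sum fun j _ => ?_
      simp only [m, Equiv.symm_apply_apply, hrot]
      rw [mul_assoc, ← pow_succ]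
      exact (pow_succ_mod_modEq hq j.2).mul_left _
    rw [digitValue_expDigit (two_le_pow_of_pos hq hn)] at h3
    refine expDigit_congr (redExp_congr (h3.trans ((redExp_modEq _ _).mul_right q)).symm ?_)
    rw [digitValue_eq_zero hq]
    have h4 : m = 0 ↔ expDigit q n e = 0 := by
      simp only [m, funext_iff, Pi.zero_apply]
      exact (finRotate n).symm.forall_congr_right (q := fun j => expDigit q n e j = 0)
    rw [h4, ← digitValue_eq_zero hq, digitValue_expDigit (two_le_pow_of_pos hq hn),
      redExp_eq_zero]
    have : q ≠ 0 := by omega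
    simp [this]
  rw [h1, h2]
  refine conjMonomial_sub_mem hF hW ?_
  have h5 : ∑ j, m j = ∑ j, expDigit q n e j := Equiv.sum_comp (finRotate n).symm (expDigit q n e)
  have := sum_expDigit_le (n := n) hq (Finset.mem_range.mp he)
  omega

/-! ### Reduction modulo a polynomial of minimal degree -/

variable {c : ℕ} {f₀ : k[X]}

/-- `f₀` is a nonzero polynomial of least degree with fake Weil descent in `W`, and
`deg f₀ ≤ q ^ c`. -/
structure IsMinimalDescent (q c : ℕ) (α : Fin n → k) (W : Submodule k (MvPolynomial (Fin n) k))
    (f₀ : k[X]) : Prop where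
  ne_zero : f₀ ≠ 0
  mem : conjDescent q α f₀ ∈ W
  natDegree_le : f₀.natDegree ≤ q ^ c
  natDegree_min : ∀ h : k[X], h ≠ 0 → conjDescent q α h ∈ W → f₀.natDegree ≤ h.natDegree

theorem exists_isMinimalDescent {f : k[X]} (hf : f ≠ 0) (hfW : conjDescent q α f ∈ W)
    (hfc : f.natDegree ≤ q ^ c) : ∃ f₀, IsMinimalDescent q c α W f₀ := by
  classical
  have hex : ∃ N : ℕ, ∃ h : k[X], h ≠ 0 ∧ conjDescent q α h ∈ W ∧ h.natDegree = N :=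
    ⟨_, f, hf, hfW, rfl⟩
  obtain ⟨f₀, h0, hW0, hN⟩ := Nat.find_spec hex
  refine ⟨f₀, h0, hW0, ?_, fun h hh hhW => ?_⟩
  · rw [hN]; exact (Nat.find_min' hex ⟨f, hf, hfW, rfl⟩).trans hfc
  · rw [hN]; exact Nat.find_min' hex ⟨h, hh, hhW, rfl⟩

theorem dvd_mod_sub (s f : k[X]) : f ∣ s % f - s := by
  rw [EuclideanDomain.mod_eq_sub_mul_div]
  exact ⟨-(s / f), by ring⟩

/-- The remainder modulo `f`, as a linear map. -/
noncomputable def modLinearMap (f : k[X]) : k[X] →ₗ[k] k[X] :=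
  modByMonicHom (f * C f.leadingCoeff⁻¹)

theorem modLinearMap_apply (f s : k[X]) : modLinearMap f s = s % f := rfl

theorem natDegree_mod_lt_of_le {s f : k[X]} {N : ℕ} (hf : f ≠ 0) (hN : 0 < N)
    (hfN : f.natDegree ≤ N) : (s % f).natDegree < N := by
  by_cases h0 : s % f = 0
  · simpa [h0] using hN
  · exact (natDegree_lt_natDegree h0 (degree_mod_lt s hf)).trans_le hfN

theorem IsMinimalDescent.dvd (h₀ : IsMinimalDescent q c α W f₀) {h : k[X]}
    (hh : conjDescent q α (h % f₀) ∈ W) : f₀ ∣ h := by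
  rw [← EuclideanDomain.mod_eq_zero]
  by_contra hne
  have h1 := natDegree_lt_natDegree hne (degree_mod_lt h h₀.ne_zero)
  have h2 := h₀.natDegree_min _ hne hh
  omega

theorem IsMinimalDescent.natDegree_mod_lt (h₀ : IsMinimalDescent q c α W f₀) (hq : 2 ≤ q)
    (s : k[X]) : (s % f₀).natDegree < q ^ c :=
  natDegree_mod_lt_of_le h₀.ne_zero (Nat.pow_pos (by omega)) h₀.natDegree_le

/-- Multiples of `f₀` of degree at most `q ^ (c + 1)` have fake Weil descent in `W`: multiply
by `X` repeatedly. -/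
theorem IsMinimalDescent.conjDescent_mul_mem (h₀ : IsMinimalDescent q c α W f₀)
    (hF : IsPowFrobenius τ q n) (hW : IsFrobeniusFallSpace τ q D W)
    (hc : (q - 1) * (c + 1) + 1 ≤ D) {a : k[X]} (ha : (f₀ * a).natDegree ≤ q ^ (c + 1)) :
    conjDescent q α (f₀ * a) ∈ W := by
  have hX : ∀ i : ℕ, f₀.natDegree + i ≤ q ^ (c + 1) → conjDescent q α (X ^ i * f₀) ∈ W := by
    intro i
    induction i with
    | zero => intro _; simpa using h₀.mem
    | succ i ih =>
      intro hi
      have hdeg : (X ^ i * f₀).natDegree < q ^ (c + 1) := by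
        rw [natDegree_X_pow_mul _ h₀.ne_zero]; omega
      have h1 := conjForm_mul_conjDescent_sub_mem (α := α) hF hW hc hdeg
      have h2 : conjForm q α 0 * conjDescent q α (X ^ i * f₀) ∈ W := by
        rw [mul_comm]
        refine hW.mul_mem _ (ih (by omega)) _ ?_
        have h3 := totalDegree_conjDescent_le (α := α) hF.two_le hdeg
        have h4 := totalDegree_conjForm_le (q := q) α 0
        omega
      rw [pow_succ', mul_assoc]
      exact (W.sub_mem_iff_right h2).mp h1
  by_cases ha0 : a = 0
  · simp [ha0]
  rw [natDegree_mul h₀.ne_zero ha0] at ha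
  rw [a.as_sum_range_C_mul_X_pow, Finset.mul_sum, map_sum]
  refine W.sum_mem fun i hi => ?_
  have : f₀ * (C (a.coeff i) * X ^ i) = a.coeff i • (X ^ i * f₀) := by
    rw [smul_eq_C_mul]; ring
  rw [this, map_smul]
  exact W.smul_mem _ (hX i (by have := Finset.mem_range.mp hi; omega))

theorem IsMinimalDescent.conjDescent_sub_mod_mem (h₀ : IsMinimalDescent q c α W f₀)
    (hF : IsPowFrobenius τ q n) (hW : IsFrobeniusFallSpace τ q D W)
    (hc : (q - 1) * (c + 1) + 1 ≤ D) {h : k[X]} (hh : h.natDegree ≤ q ^ (c + 1)) :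
    conjDescent q α h - conjDescent q α (h % f₀) ∈ W := by
  have h1 : h - h % f₀ = f₀ * (h / f₀) := by
    rw [EuclideanDomain.mod_eq_sub_mul_div]; ring
  rw [← map_sub, h1]
  refine h₀.conjDescent_mul_mem hF hW hc ?_
  rw [← h1]
  refine (natDegree_sub_le _ _).trans (max_le hh ?_)
  refine (h₀.natDegree_mod_lt hF.two_le h).le.trans (Nat.pow_le_pow_right ?_ (by omega))
  have := hF.two_le
  omega

/-- Iterating the Frobenius on coefficients corresponds to raising to the `q ^ j`-th power modulo
`f₀`. All degrees stay small, since `f₀` reduces the polynomial after each step. -/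
theorem IsMinimalDescent.iterate_map_sub_mem (h₀ : IsMinimalDescent q c α W f₀)
    (hF : IsPowFrobenius τ q n) (hW : IsFrobeniusFallSpace τ q D W)
    (hc : (q - 1) * (c + 1) + 1 ≤ D) {s : k[X]} (hs : s.natDegree ≤ q ^ (c + 1)) (j : ℕ) :
    (MvPolynomial.map τ)^[j] (conjDescent q α s) - conjDescent q α (s ^ q ^ j % f₀) ∈ W := by
  have hq := hF.two_le
  induction j with
  | zero => simpa using h₀.conjDescent_sub_mod_mem hF hW hc hs
  | succ j ih =>
    rw [Function.iterate_succ_apply']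
    have ht := h₀.natDegree_mod_lt hq (s ^ q ^ j)
    set t := s ^ q ^ j % f₀ with ht_def
    have h1 := hW.map_sub_mem ih
    have h2 := map_conjDescent_sub_mem (α := α) hF hW hc
      (ht.trans_le (Nat.pow_le_pow_right (by omega) (Nat.le_succ c)))
    have h3 := h₀.conjDescent_sub_mod_mem hF hW hc (h := t ^ q) (by
      refine natDegree_pow_le.trans ?_
      rw [pow_succ']
      exact Nat.mul_le_mul_left _ ht.le)
    have h4 : t ^ q % f₀ = s ^ q ^ (j + 1) % f₀ := by
      refine mod_eq_of_dvd_sub ?_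
      rw [pow_succ, pow_mul]
      exact (dvd_mod_sub _ _).trans (sub_dvd_pow_sub_pow _ _ _)
    rw [← h4]
    exact sub_mem_trans h1 (sub_mem_trans h2 h3)

theorem coeff_iterate_map (hF : IsPowFrobenius τ q n) (g : MvPolynomial (Fin n) k) (j : ℕ)
    (m : Fin n →₀ ℕ) : ((MvPolynomial.map τ)^[j] g).coeff m = g.coeff m ^ q ^ j := by
  induction j with
  | zero => simp
  | succ j ih =>
    rw [Function.iterate_succ_apply', MvPolynomial.coeff_map, ih, hF.apply_eq, ← pow_mul,
      ← pow_succ]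

theorem iterate_map_card (hF : IsPowFrobenius τ q n) (g : MvPolynomial (Fin n) k) :
    (MvPolynomial.map τ)^[n] g = g := by
  ext m
  rw [coeff_iterate_map hF, hF.pow_card]

theorem iterate_map_conjForm (hF : IsPowFrobenius τ q n) (i j : ℕ) :
    (MvPolynomial.map τ)^[j] (conjForm q α i) = conjForm q α (i + j) := by
  induction j with
  | zero => simp
  | succ j ih => rw [Function.iterate_succ_apply', ih, map_conjForm hF.apply_eq]; rfl

theorem IsFrobeniusFallSpace.iterate_map_sub_mem (hW : IsFrobeniusFallSpace τ q D W)
    {g h : MvPolynomial (Fin n) k} (hgh : g - h ∈ W) (j : ℕ) :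
    (MvPolynomial.map τ)^[j] g - (MvPolynomial.map τ)^[j] h ∈ W := by
  induction j with
  | zero => simpa using hgh
  | succ j ih =>
    rw [Function.iterate_succ_apply', Function.iterate_succ_apply']
    exact hW.map_sub_mem ih

theorem totalDegree_iterate_map_le (τ : k →+* k) (g : MvPolynomial (Fin n) k) (j : ℕ) :
    ((MvPolynomial.map τ)^[j] g).totalDegree ≤ g.totalDegree := by
  induction j with
  | zero => simp
  | succ j ih =>
    rw [Function.iterate_succ_apply']
    exact (totalDegree_map_le _ _).trans ih

/-- By minimality `f₀` divides `s ^ (q ^ n) - s`: the `n`-fold Frobenius fixes `s̄`. -/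
theorem IsMinimalDescent.dvd_pow_card_sub (h₀ : IsMinimalDescent q c α W f₀)
    (hF : IsPowFrobenius τ q n) (hW : IsFrobeniusFallSpace τ q D W)
    (hc : (q - 1) * (c + 1) + 1 ≤ D) {s : k[X]} (hs : s.natDegree ≤ q ^ (c + 1)) :
    f₀ ∣ s ^ q ^ n - s := by
  have h1 := h₀.iterate_map_sub_mem hF hW hc hs n
  have h2 := h₀.conjDescent_sub_mod_mem hF hW hc hs
  rw [iterate_map_card hF] at h1
  refine h₀.dvd ?_
  rw [sub_mod, map_sub]
  simpa using W.sub_mem h2 h1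

/-- Multiplication by `Y_j` corresponds to multiplication by `X ^ (q ^ j)` modulo `f₀`. For `j = 0`
this is multiplication by `X`; the general case is conjugate to it under a power of the Frobenius,
so that the degrees stay small. -/
theorem IsMinimalDescent.conjForm_mul_sub_mem (h₀ : IsMinimalDescent q c α W f₀)
    (hF : IsPowFrobenius τ q n) (hW : IsFrobeniusFallSpace τ q D W)
    (hc : (q - 1) * (c + 1) + 1 ≤ D) {s : k[X]} (hs : s.natDegree < q ^ c) {j : ℕ} (hj : j ≤ n) :
    conjForm q α j * conjDescent q α s - conjDescent q α (X ^ q ^ j * s % f₀) ∈ W := by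
  have hq := hF.two_le
  have hcc : q ^ c ≤ q ^ (c + 1) := Nat.pow_le_pow_right (by omega) (Nat.le_succ c)
  -- apply the Frobenius `n - j` times, multiply by `Y_0`, and apply it `j` more times
  set i := n - j with hi
  set s' := s ^ q ^ i % f₀ with hs'
  have hs'c : s'.natDegree < q ^ c := h₀.natDegree_mod_lt hq _
  have h1 : (MvPolynomial.map τ)^[i] (conjDescent q α s) - conjDescent q α s' ∈ W :=
    h₀.iterate_map_sub_mem hF hW hc (hs.le.trans hcc) i
  have hy := totalDegree_conjForm_le (q := q) α 0
  have hds := totalDegree_conjDescent_le (α := α) hq (hs.trans_le hcc)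
  have hds' := totalDegree_conjDescent_le (α := α) hq (hs'c.trans_le hcc)
  have h2 := hW.mul_sub_mul_mem (f := conjForm q α 0) h1
    (by have := totalDegree_iterate_map_le τ (conjDescent q α s) i; omega) (by omega)
  have h3 := conjForm_mul_conjDescent_sub_mem (α := α) hF hW hc (hs'c.trans_le hcc)
  have h4 := hW.iterate_map_sub_mem (sub_mem_trans h2 h3) j
  rw [iterate_map_mul, iterate_map_conjForm hF, zero_add, ← Function.iterate_add_apply,
    show j + i = n by omega, iterate_map_card hF] at h4
  have h5 := h₀.iterate_map_sub_mem hF hW hc (s := X * s') (by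
    refine natDegree_mul_le.trans ?_
    rw [natDegree_X]
    omega) j
  have h6 : (X * s') ^ q ^ j % f₀ = X ^ q ^ j * s % f₀ := by
    refine mod_eq_of_dvd_sub ?_
    rw [mul_pow, ← mul_sub]
    refine Dvd.dvd.mul_left ?_ _
    have h7 : f₀ ∣ s' ^ q ^ j - s ^ q ^ n := by
      rw [show n = i + j by omega, pow_add, pow_mul]
      exact (dvd_mod_sub _ _).trans (sub_dvd_pow_sub_pow _ _ _)
    have h8 := h₀.dvd_pow_card_sub hF hW hc (hs.le.trans hcc)
    simpa using dvd_add h7 h8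
  rw [h6] at h5
  exact sub_mem_trans h4 h5

/-- The substitution `X_i ↦ ∑ j, β_i ^ (q ^ j) * X ^ (q ^ j)`. When `β` is the trace dual basis of
`α`, it sends the conjugate form `Y_j` to `X ^ (q ^ j)`. -/
noncomputable def traceSubst (q : ℕ) (β : Fin n → k) : MvPolynomial (Fin n) k →ₐ[k] k[X] :=
  MvPolynomial.aeval fun i => ∑ j : Fin n, C (β i ^ q ^ (j : ℕ)) * X ^ q ^ (j : ℕ)

/-- Every polynomial `P` of degree at most `D` is congruent modulo `W` to the fake Weil descent of
the remainder modulo `f₀` of the univariate polynomial which `P` stands for. -/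
theorem IsMinimalDescent.sub_conjDescent_mem (h₀ : IsMinimalDescent q c α W f₀)
    (hF : IsPowFrobenius τ q n) (hW : IsFrobeniusFallSpace τ q D W)
    (hc : (q - 1) * (c + 1) + 1 ≤ D) {β : Fin n → k}
    (hβ : ∀ i, (MvPolynomial.X i : MvPolynomial (Fin n) k) =
      ∑ j : Fin n, MvPolynomial.C (β i ^ q ^ (j : ℕ)) * conjForm q α j)
    {P : MvPolynomial (Fin n) k} (hP : P.totalDegree ≤ D) :
    P - conjDescent q α (traceSubst q β P % f₀) ∈ W := by
  have hq := hF.two_le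
  have hcc : q ^ c ≤ q ^ (c + 1) := Nat.pow_le_pow_right (by omega) (Nat.le_succ c)
  have hmon : ∀ (N : ℕ) (m : Fin n →₀ ℕ), m.degree = N → N ≤ D →
      MvPolynomial.monomial m (1 : k) -
        conjDescent q α (traceSubst q β (MvPolynomial.monomial m 1) % f₀) ∈ W := by
    intro N
    induction N with
    | zero =>
      intro m hm _
      rw [Finsupp.degree_eq_zero_iff] at hm
      subst hm
      have h1 := h₀.conjDescent_sub_mod_mem hF hW hc (h := 1) (by simp)
      have h2 : conjDescent q α (1 : k[X]) = 1 := by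
        rw [← monomial_zero_one, conjDescent_monomial]
        simp [conjMonomial, expDigit, redExp]
      rw [h2] at h1
      simpa using h1
    | succ N ih =>
      intro m hm hN
      obtain ⟨i, hi⟩ : ∃ i, m i ≠ 0 := by
        by_contra! h
        have : m = 0 := Finsupp.ext h
        simp [this] at hm
      obtain ⟨m', rfl⟩ : ∃ m', m = Finsupp.single i 1 + m' :=
        ⟨m - Finsupp.single i 1, (add_tsub_cancel_of_le (by
          rw [Finsupp.single_le_iff]; omega)).symm⟩
      have hm' : m'.degree = N := by
        rw [map_add, Finsupp.degree_single] at hm; omega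
      have hX : (MvPolynomial.monomial (Finsupp.single i 1 + m') 1 : MvPolynomial (Fin n) k) =
          MvPolynomial.X i * MvPolynomial.monomial m' 1 := by
        rw [MvPolynomial.X, MvPolynomial.monomial_mul, one_mul]
      have h1 := ih m' hm' (by omega)
      set P' : MvPolynomial (Fin n) k := MvPolynomial.monomial m' 1 with hP'
      have hs := h₀.natDegree_mod_lt hq (traceSubst q β P')
      set s := traceSubst q β P' % f₀ with hs_def
      have hds := totalDegree_conjDescent_le (α := α) hq (hs.trans_le hcc)
      have hdP : P'.totalDegree ≤ N := by
        refine (MvPolynomial.totalDegree_monomial_le _ _).trans ?_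
        rw [← hm', Finsupp.degree_eq_sum, Finsupp.sum_fintype _ _ (by simp)]
        simp
      have hdX : (MvPolynomial.X i : MvPolynomial (Fin n) k).totalDegree = 1 :=
        MvPolynomial.totalDegree_X i
      have h2 := hW.mul_sub_mul_mem (f := MvPolynomial.X i) h1 (by omega) (by omega)
      have h3 : MvPolynomial.X i * conjDescent q α s -
          conjDescent q α (traceSubst q β (MvPolynomial.X i * P') % f₀) ∈ W := by
        have h4 : traceSubst q β (MvPolynomial.X i * P') % f₀ =
            ∑ j : Fin n, (β i ^ q ^ (j : ℕ)) • (X ^ q ^ (j : ℕ) * s % f₀) := by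
          have h5 : traceSubst q β (MvPolynomial.X i * P') % f₀ =
              (∑ j : Fin n, (C (β i ^ q ^ (j : ℕ)) * X ^ q ^ (j : ℕ))) * s % f₀ := by
            refine mod_eq_of_dvd_sub ?_
            rw [map_mul, show traceSubst q β (MvPolynomial.X i) = _ from
              MvPolynomial.aeval_X _ _, ← mul_sub]
            refine Dvd.dvd.mul_left ?_ _
            rw [dvd_sub_comm]
            exact dvd_mod_sub _ _
          rw [h5, Finset.sum_mul, ← modLinearMap_apply, map_sum]
          refine Finset.sum_congr rfl fun j _ => ?_
          rw [mul_assoc, ← smul_eq_C_mul, map_smul, modLinearMap_apply]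
        rw [h4, map_sum, hβ i, Finset.sum_mul, ← Finset.sum_sub_distrib]
        refine W.sum_mem fun j _ => ?_
        rw [map_smul, mul_assoc, ← MvPolynomial.smul_eq_C_mul, ← smul_sub]
        exact W.smul_mem _ (h₀.conjForm_mul_sub_mem hF hW hc hs j.2.le)
      rw [hX]
      exact sub_mem_trans h2 h3
  let L : MvPolynomial (Fin n) k →ₗ[k] MvPolynomial (Fin n) k :=
    LinearMap.id - conjDescent q α ∘ₗ modLinearMap f₀ ∘ₗ (traceSubst q β).toLinearMap
  have hL : ∀ Q, Q - conjDescent q α (traceSubst q β Q % f₀) = L Q := fun _ => rfl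
  rw [hL, P.as_sum, map_sum]
  refine W.sum_mem fun m hm => ?_
  rw [← mul_one (P.coeff m), ← smul_eq_mul, ← MvPolynomial.smul_monomial, map_smul]
  refine W.smul_mem _ (hmon _ m rfl (le_trans ?_ hP))
  exact MvPolynomial.le_totalDegree hm

end Core

/-! ### Fall spaces and extension of the base field -/

section FallSpace

variable {σ K : Type*} [Field K]

theorem mem_fallSpace {E : Set (MvPolynomial σ K)} {i : ℕ} {f : MvPolynomial σ K} (hf : f ∈ E)
    (hd : f.totalDegree ≤ i) : f ∈ fallSpace E i :=
  Submodule.mem_sInf.mpr fun _ hW => hW.1 f hf hd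

theorem mul_mem_fallSpace {E : Set (MvPolynomial σ K)} {i : ℕ} {g h : MvPolynomial σ K}
    (hg : g ∈ fallSpace E i) (hd : (g * h).totalDegree ≤ i) : g * h ∈ fallSpace E i :=
  Submodule.mem_sInf.mpr fun W hW => hW.2 g (Submodule.mem_sInf.mp hg W hW) h hd

end FallSpace

section Extend

variable {σ k' k : Type*} [Field k'] [Field k] [Algebra k' k]

/-- Apply a `k'`-linear form `l : k → k'` to all coefficients of a polynomial. -/
noncomputable def coeffMap (l : k →ₗ[k'] k') : MvPolynomial σ k →+ MvPolynomial σ k' where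
  toFun p := AddMonoidAlgebra.map l.toAddMonoidHom p
  map_zero' := AddMonoidAlgebra.map_zero _
  map_add' := AddMonoidAlgebra.map_add _

@[simp]
theorem coeff_coeffMap (l : k →ₗ[k'] k') (p : MvPolynomial σ k) (m : σ →₀ ℕ) :
    MvPolynomial.coeff m (coeffMap l p) = l (MvPolynomial.coeff m p) := rfl

theorem totalDegree_coeffMap_le (l : k →ₗ[k'] k') (p : MvPolynomial σ k) :
    (coeffMap l p).totalDegree ≤ p.totalDegree := by
  refine Finset.sup_mono fun m hm => ?_
  rw [MvPolynomial.mem_support_iff] at hm ⊢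
  intro h
  exact hm (by rw [coeff_coeffMap, h, map_zero])

theorem coeffMap_smul (l : k →ₗ[k'] k') (a : k) (p : MvPolynomial σ k) :
    coeffMap l (a • p) = coeffMap (l ∘ₗ LinearMap.mulLeft k' a) p := by
  ext m; simp

theorem coeffMap_mul_monomial (l : k →ₗ[k'] k') (p : MvPolynomial σ k) (m : σ →₀ ℕ) (a : k) :
    coeffMap l (p * MvPolynomial.monomial m a) =
      coeffMap (l ∘ₗ LinearMap.mulRight k' a) p * MvPolynomial.monomial m 1 := by
  ext m'
  simp only [coeff_coeffMap, MvPolynomial.coeff_mul_monomial']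
  split_ifs <;> simp

theorem coeffMap_map_algebraMap (l : k →ₗ[k'] k') (p : MvPolynomial σ k') :
    coeffMap l (MvPolynomial.map (algebraMap k' k) p) = l 1 • p := by
  ext m
  simp [MvPolynomial.coeff_map, Algebra.algebraMap_eq_smul_one, mul_comm]

theorem coeffMap_map (l : k →ₗ[k'] k') (τ : k →ₐ[k'] k) (p : MvPolynomial σ k) :
    coeffMap l (MvPolynomial.map (τ : k →+* k) p) = coeffMap (l ∘ₗ τ.toLinearMap) p := by
  ext m; simp [MvPolynomial.coeff_map]

/-- The extension of scalars `k ⊗ V` of a subspace `V` of the polynomials over `k'`, described as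
the space of the polynomials over `k` all of whose coordinates over `k'` lie in `V`. -/
noncomputable def extendScalars (k : Type*) [Field k] [Algebra k' k]
    (V : Submodule k' (MvPolynomial σ k')) : Submodule k (MvPolynomial σ k) where
  carrier := {p | ∀ l : k →ₗ[k'] k', coeffMap l p ∈ V}
  zero_mem' l := by rw [map_zero]; exact V.zero_mem
  add_mem' hp hq l := by rw [map_add]; exact V.add_mem (hp l) (hq l)
  smul_mem' a p hp l := by rw [coeffMap_smul]; exact hp _

theorem mem_extendScalars {V : Submodule k' (MvPolynomial σ k')} {p : MvPolynomial σ k} :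
    p ∈ extendScalars k V ↔ ∀ l : k →ₗ[k'] k', coeffMap l p ∈ V := Iff.rfl

theorem map_mem_extendScalars_iff {V : Submodule k' (MvPolynomial σ k')}
    {p : MvPolynomial σ k'} : MvPolynomial.map (algebraMap k' k) p ∈ extendScalars k V ↔ p ∈ V := by
  rw [mem_extendScalars]
  simp only [coeffMap_map_algebraMap]
  refine ⟨fun h => ?_, fun h l => V.smul_mem _ h⟩
  obtain ⟨l, h1⟩ : ∃ l : k →ₗ[k'] k', l 1 ≠ 0 := by
    by_contra! h0
    exact one_ne_zero ((Module.forall_dual_apply_eq_zero_iff k' (1 : k)).mp h0)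
  have := V.smul_mem (l 1)⁻¹ (h l)
  rwa [smul_smul, inv_mul_cancel₀ h1, one_smul] at this

theorem mul_mem_extendScalars_fallSpace {E : Set (MvPolynomial σ k')} {D : ℕ}
    {g h : MvPolynomial σ k} (hg : g ∈ extendScalars k (fallSpace E D))
    (hd : g.totalDegree + h.totalDegree ≤ D) : g * h ∈ extendScalars k (fallSpace E D) := by
  rw [h.as_sum, Finset.mul_sum]
  refine Submodule.sum_mem _ fun m hm l => ?_
  rw [coeffMap_mul_monomial]
  refine mul_mem_fallSpace (hg _) ((MvPolynomial.totalDegree_mul _ _).trans ?_)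
  refine le_trans (add_le_add (totalDegree_coeffMap_le _ _) ?_) hd
  exact (MvPolynomial.totalDegree_monomial_le _ _).trans (MvPolynomial.le_totalDegree hm)

theorem isFrobeniusFallSpace_extendScalars {n q D : ℕ} {E : Set (MvPolynomial (Fin n) k')}
    (τ : k →ₐ[k'] k)
    (hE : ∀ i, (MvPolynomial.X i ^ q - MvPolynomial.X i : MvPolynomial (Fin n) k') ∈
      fallSpace E D) :
    IsFrobeniusFallSpace (τ : k →+* k) q D (extendScalars k (fallSpace E D)) where
  mul_mem _ hg _ hd := mul_mem_extendScalars_fallSpace hg hd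
  map_mem g hg l := by rw [coeffMap_map]; exact hg _
  field_mem i := by
    have := map_mem_extendScalars_iff (k := k).mpr (hE i)
    simpa using this

theorem coeffMap_coord_sum {n : ℕ} (α : Module.Basis (Fin n) k' k)
    (g : Fin n → MvPolynomial (Fin n) k') (j : Fin n) :
    coeffMap (α.coord j) (∑ i, MvPolynomial.C (α i) * MvPolynomial.map (algebraMap k' k) (g i)) =
      g j := by
  rw [map_sum, Finset.sum_eq_single j]
  · rw [← MvPolynomial.smul_eq_C_mul, coeffMap_smul, coeffMap_map_algebraMap]
    simp
  · intro i _ hi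
    rw [← MvPolynomial.smul_eq_C_mul, coeffMap_smul, coeffMap_map_algebraMap]
    simp [hi]
  · simp

end Extend

/-! ### Reduction modulo the field equations -/

section Reduce

variable {σ k : Type*} [Field k] {q : ℕ}

/-- Reduction modulo the field equations `X_i ^ q = X_i`: the linear map which replaces every
exponent in a monomial by the equivalent one below `q`. -/
noncomputable def fieldReduce (q : ℕ) : MvPolynomial σ k →ₗ[k] MvPolynomial σ k :=
  (MvPolynomial.basisMonomials σ k).constr k fun m =>
    MvPolynomial.monomial (m.mapRange (redExp q) (redExp_zero q)) 1

theorem fieldReduce_monomial (m : σ →₀ ℕ) (a : k) :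
    fieldReduce q (MvPolynomial.monomial m a) =
      MvPolynomial.monomial (m.mapRange (redExp q) (redExp_zero q)) a := by
  have h := (MvPolynomial.basisMonomials σ k).constr_basis k
    (fun m => (MvPolynomial.monomial (m.mapRange (redExp q) (redExp_zero q)) 1 : MvPolynomial σ k)) m
  rw [MvPolynomial.coe_basisMonomials] at h
  rw [← mul_one a, ← smul_eq_mul, ← MvPolynomial.smul_monomial, map_smul, fieldReduce, h,
    MvPolynomial.smul_monomial]

theorem totalDegree_fieldReduce_le [Finite σ] (p : MvPolynomial σ k) :
    (fieldReduce q p).totalDegree ≤ p.totalDegree := by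
  have := Fintype.ofFinite σ
  conv_lhs => rw [p.as_sum, map_sum]
  refine MvPolynomial.totalDegree_finsetSum_le fun m hm => ?_
  rw [fieldReduce_monomial]
  refine (MvPolynomial.totalDegree_monomial_le _ _).trans
    (le_trans ?_ (MvPolynomial.le_totalDegree hm))
  rw [Finsupp.sum_fintype _ _ (by simp), Finsupp.sum_fintype _ _ (by simp)]
  exact Finset.sum_le_sum fun i _ => redExp_le _ _

theorem mapRange_redExp_of_lt {m : σ →₀ ℕ} (hm : ∀ i, m i < q) :
    m.mapRange (redExp q) (redExp_zero q) = m := by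
  ext i; exact redExp_eq_self (hm i)

theorem fieldReduce_eq_self (hq : 2 ≤ q) {p : MvPolynomial σ k}
    (hp : ∀ i, p.degreeOf i ≤ q - 1) : fieldReduce q p = p := by
  conv_lhs => rw [p.as_sum, map_sum]
  conv_rhs => rw [p.as_sum]
  refine Finset.sum_congr rfl fun m hm => ?_
  rw [fieldReduce_monomial, mapRange_redExp_of_lt]
  intro i
  have := (MvPolynomial.monomial_le_degreeOf i hm).trans (hp i)
  omega

theorem mapRange_redExp_add_single (m : σ →₀ ℕ) (i : σ) (hq : 2 ≤ q) :
    (m + Finsupp.single i q).mapRange (redExp q) (redExp_zero q) =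
      (m + Finsupp.single i 1).mapRange (redExp q) (redExp_zero q) := by
  classical
  ext l
  rw [Finsupp.mapRange_apply, Finsupp.mapRange_apply, Finsupp.add_apply, Finsupp.add_apply]
  by_cases h : i = l
  · subst h
    rw [Finsupp.single_eq_same, Finsupp.single_eq_same]
    refine redExp_congr (Nat.ModEq.add_left _ ?_) (by omega)
    exact ((Nat.modEq_iff_dvd' (by omega)).mpr dvd_rfl).symm
  · rw [Finsupp.single_eq_of_ne' h, Finsupp.single_eq_of_ne' h]

theorem monomial_mul_field_eq (m : σ →₀ ℕ) (i : σ) (a : k) :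
    MvPolynomial.monomial m a * (MvPolynomial.X i ^ q - MvPolynomial.X i) =
      MvPolynomial.monomial (m + Finsupp.single i q) a -
        MvPolynomial.monomial (m + Finsupp.single i 1) a := by
  rw [mul_sub, MvPolynomial.X_pow_eq_monomial, MvPolynomial.X, MvPolynomial.monomial_mul,
    MvPolynomial.monomial_mul, mul_one]

theorem fieldReduce_eq_zero [Finite σ] (hq : 2 ≤ q) {p : MvPolynomial σ k}
    (hp : p ∈ Ideal.span (Set.range fun j : σ =>
      (MvPolynomial.X j ^ q - MvPolynomial.X j : MvPolynomial σ k))) : fieldReduce q p = 0 := by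
  have := Fintype.ofFinite σ
  obtain ⟨c, rfl⟩ := Ideal.mem_span_range_iff_exists_fun.mp hp
  rw [map_sum]
  refine Finset.sum_eq_zero fun i _ => ?_
  rw [(c i).as_sum, Finset.sum_mul, map_sum]
  refine Finset.sum_eq_zero fun m _ => ?_
  rw [monomial_mul_field_eq, map_sub, fieldReduce_monomial, fieldReduce_monomial,
    mapRange_redExp_add_single _ _ hq, sub_self]

variable {n D : ℕ} {τ : k →+* k} {W : Submodule k (MvPolynomial (Fin n) k)}

/-- The reduction modulo the field equations takes place in `W`, since it does not raise
degrees. -/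
theorem IsFrobeniusFallSpace.sub_fieldReduce_mem (hW : IsFrobeniusFallSpace τ q D W) (hq : 2 ≤ q)
    {p : MvPolynomial (Fin n) k} (hp : p.totalDegree ≤ D) : p - fieldReduce q p ∈ W := by
  have hmon : ∀ (N : ℕ) (m : Fin n →₀ ℕ), m.degree = N → N ≤ D →
      MvPolynomial.monomial m (1 : k) - fieldReduce q (MvPolynomial.monomial m 1) ∈ W := by
    intro N
    induction N using Nat.strong_induction_on with
    | _ N ih =>
      intro m hm hN
      by_cases h : ∀ i, m i < q
      · rw [fieldReduce_monomial, mapRange_redExp_of_lt h, sub_self]; exact W.zero_mem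
      · push Not at h
        obtain ⟨i, hi⟩ := h
        obtain ⟨m', rfl⟩ : ∃ m' : Fin n →₀ ℕ, m = m' + Finsupp.single i q :=
          ⟨m - Finsupp.single i q, (tsub_add_cancel_of_le (Finsupp.single_le_iff.mpr hi)).symm⟩
        rw [map_add, Finsupp.degree_single] at hm
        have h1 := ih (m'.degree + 1) (by omega) (m' + Finsupp.single i 1)
          (by rw [map_add, Finsupp.degree_single]) (by omega)
        rw [fieldReduce_monomial, mapRange_redExp_add_single _ _ hq, ← fieldReduce_monomial]
        refine sub_mem_trans ?_ h1
        rw [← monomial_mul_field_eq, mul_comm]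
        refine hW.mul_mem _ (hW.field_mem i) _ ?_
        have h2 : (MvPolynomial.X i ^ q - MvPolynomial.X i : MvPolynomial (Fin n) k).totalDegree
            ≤ q := by
          refine (MvPolynomial.totalDegree_sub _ _).trans ?_
          rw [MvPolynomial.totalDegree_X_pow, MvPolynomial.totalDegree_X]
          omega
        have h3 : (MvPolynomial.monomial m' (1 : k)).totalDegree ≤ m'.degree := by
          refine (MvPolynomial.totalDegree_monomial_le _ _).trans ?_
          rw [Finsupp.degree_eq_sum, Finsupp.sum_fintype _ _ (by simp)]
          simp
        omega
  have hL : p - fieldReduce q p =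
      (LinearMap.id - fieldReduce q : MvPolynomial (Fin n) k →ₗ[k] MvPolynomial (Fin n) k) p := rfl
  rw [hL, p.as_sum, map_sum]
  refine W.sum_mem fun m hm => ?_
  rw [← mul_one (p.coeff m), ← smul_eq_mul, ← MvPolynomial.smul_monomial, map_smul]
  exact W.smul_mem _ (hmon _ m rfl ((MvPolynomial.le_totalDegree hm).trans hp))

/-- Evaluation at polynomials of degree at most one does not raise the degree. -/
theorem totalDegree_aeval_le {ρ : Type*} [Finite ρ] {y : ρ → MvPolynomial σ k}
    (hy : ∀ j, (y j).totalDegree ≤ 1) (p : MvPolynomial ρ k) :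
    (MvPolynomial.aeval y p).totalDegree ≤ p.totalDegree := by
  have := Fintype.ofFinite ρ
  conv_lhs => rw [p.as_sum, map_sum]
  refine MvPolynomial.totalDegree_finsetSum_le fun m hm => ?_
  rw [MvPolynomial.aeval_monomial, MvPolynomial.algebraMap_eq]
  refine (MvPolynomial.totalDegree_mul _ _).trans ?_
  rw [MvPolynomial.totalDegree_C, zero_add, Finsupp.prod_fintype _ _ (by simp)]
  refine (MvPolynomial.totalDegree_finsetProd _ _).trans
    (le_trans ?_ (MvPolynomial.le_totalDegree hm))
  rw [Finsupp.sum_fintype _ _ (by simp)]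
  refine Finset.sum_le_sum fun j _ => (MvPolynomial.totalDegree_pow _ _).trans ?_
  exact (Nat.mul_le_mul_left _ (hy j)).trans (by simp)

/-- Modulo the field equations the fake Weil descent of `f`, evaluated at the conjugate forms, is
`f (∑ i, α_i X_i)`. -/
theorem conjDescent_sub_aeval_mem (hF : IsPowFrobenius τ q n) (α : Fin n → k) (f : k[X]) :
    conjDescent q α f - Polynomial.aeval (∑ j, MvPolynomial.C (α j) * MvPolynomial.X j :
      MvPolynomial (Fin n) k) f ∈ Ideal.span (Set.range fun j : Fin n =>
        (MvPolynomial.X j ^ q - MvPolynomial.X j : MvPolynomial (Fin n) k)) := by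
  set I := Ideal.span (Set.range fun j : Fin n =>
        (MvPolynomial.X j ^ q - MvPolynomial.X j : MvPolynomial (Fin n) k)) with hI
  have h0 : (∑ j, MvPolynomial.C (α j) * MvPolynomial.X j : MvPolynomial (Fin n) k) =
      conjForm q α 0 := by simp [conjForm]
  have hstep : ∀ j, Ideal.Quotient.mk I (conjForm q α 0) ^ q ^ j =
      Ideal.Quotient.mk I (conjForm q α j) := by
    intro j
    induction j with
    | zero => simp
    | succ j ih =>
      rw [pow_succ, pow_mul, ih, ← map_pow, Ideal.Quotient.eq]
      exact conjForm_pow_sub_mem (W := I.restrictScalars k) hF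
        (fun i => Ideal.subset_span ⟨i, rfl⟩) j
  rw [h0]
  induction f using Polynomial.induction_on' with
  | add f g hf hg =>
    rw [map_add, map_add, add_sub_add_comm]
    exact I.add_mem hf hg
  | monomial e a =>
    rw [conjDescent_monomial, aeval_monomial, ← Algebra.smul_def, ← smul_sub,
      MvPolynomial.smul_eq_C_mul]
    refine I.mul_mem_left _ ?_
    rw [← Ideal.Quotient.eq, conjMonomial, map_prod, map_pow]
    have h2 : ∀ j : Fin n, Ideal.Quotient.mk I (conjForm q α j ^ expDigit q n e j) =
        Ideal.Quotient.mk I (conjForm q α 0) ^ (q ^ (j : ℕ) * expDigit q n e j) := fun j => by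
      rw [map_pow, ← hstep, ← pow_mul]
    rw [Finset.prod_congr rfl fun j _ => h2 j, Finset.prod_pow_eq_pow_sum]
    have h1 : ∑ j : Fin n, q ^ (j : ℕ) * expDigit q n e j = redExp (q ^ n) e := by
      rw [← digitValue_expDigit (two_le_pow_of_pos hF.two_le hF.pos)]
      exact Finset.sum_congr rfl fun j _ => mul_comm _ _
    rw [h1]
    refine pow_redExp (two_le_pow_of_pos hF.two_le hF.pos) ?_ e
    rw [hstep]
    simpa using congrArg (Ideal.Quotient.mk I) (conjForm_add_period (α := α) hF.pow_card 0)

end Reduce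

/-! ### Weil descent and fake Weil descent -/

section Main

variable {k' k : Type*} [Field k'] [Finite k'] [Field k] [Algebra k' k] {q n : ℕ}

/-- The `q`-power Frobenius of `k` over the field `k'` with `q` elements. -/
noncomputable def natFrobenius (k' k : Type*) [Field k'] [Finite k'] [Field k] [Algebra k' k] :
    k →ₐ[k'] k :=
  letI := Fintype.ofFinite k'
  FiniteField.frobeniusAlgHom k' k

theorem natFrobenius_apply (a : k) : natFrobenius k' k a = a ^ Nat.card k' := by
  let := Fintype.ofFinite k'
  rw [Nat.card_eq_fintype_card]
  rfl

theorem isPowFrobenius_natFrobenius (hq : Nat.card k' = q) (hk : Nat.card k = q ^ n) :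
    IsPowFrobenius (natFrobenius k' k : k →+* k) q n := by
  have hq2 : 2 ≤ q := hq ▸ Finite.one_lt_card
  have : Finite k := Nat.finite_of_card_ne_zero (by rw [hk]; positivity)
  have hk2 : 1 < Nat.card k := Finite.one_lt_card
  let := Fintype.ofFinite k'
  let := Fintype.ofFinite k
  refine ⟨?_, hq2, ?_, fun a => hq ▸ natFrobenius_apply a, fun a => ?_⟩
  · obtain ⟨p, _, r, hpk, hr⟩ := FiniteField.card' k'
    have : CharP k p := charP_of_injective_algebraMap' k' p
    exact ⟨p, r, ExpChar.prime hpk, by rw [← hq, Nat.card_eq_fintype_card, hr]⟩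
  · rw [Nat.pos_iff_ne_zero]
    rintro rfl
    rw [hk, pow_zero] at hk2
    omega
  · rw [← hk, Nat.card_eq_fintype_card, FiniteField.pow_card]

/-- Every variable is a linear combination of the conjugate forms, with the Frobenius conjugates of
the trace dual basis as coefficients. -/
theorem X_eq_sum_conjForm [Finite k] (hq : Nat.card k' = q) (α : Module.Basis (Fin n) k' k)
    (i : Fin n) : (MvPolynomial.X i : MvPolynomial (Fin n) k) =
      ∑ j : Fin n, MvPolynomial.C (α.traceDual i ^ q ^ (j : ℕ)) * conjForm q α j := by
  have hrank : Module.finrank k' k = n := by simp [Module.finrank_eq_card_basis α]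
  have htr : ∀ l, ∑ j : Fin n, (α.traceDual i * α l) ^ q ^ (j : ℕ) = if l = i then 1 else 0 := by
    intro l
    have h := FiniteField.algebraMap_trace_eq_sum_pow k' k (α.traceDual i * α l)
    rw [Module.Basis.trace_traceDual_mul, hrank, hq, Finset.sum_range] at h
    rw [← h]
    split_ifs <;> simp
  simp only [conjForm, Finset.mul_sum]
  rw [Finset.sum_comm]
  have h1 : ∀ l : Fin n, ∑ j : Fin n, MvPolynomial.C (α.traceDual i ^ q ^ (j : ℕ)) *
      (MvPolynomial.C (α l ^ q ^ (j : ℕ)) * MvPolynomial.X l) =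
      MvPolynomial.C (if l = i then (1 : k) else 0) * MvPolynomial.X l := by
    intro l
    rw [← htr, map_sum, Finset.sum_mul]
    refine Finset.sum_congr rfl fun j _ => ?_
    rw [← mul_assoc, ← map_mul, mul_pow]
  rw [Finset.sum_congr rfl fun l _ => h1 l, Finset.sum_eq_single i]
  · simp
  · intro l _ hl; simp [hl]
  · simp

/-- The polynomial `∑ j, α_j [f]_j` is the reduction of the fake Weil descent of `f`, evaluated at
the conjugate forms, modulo the field equations. -/
theorem fieldReduce_conjDescent (hq : Nat.card k' = q) (hk : Nat.card k = q ^ n)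
    (α : Module.Basis (Fin n) k' k) (f : k[X]) :
    fieldReduce q (conjDescent q α f) =
      ∑ j, MvPolynomial.C (α j) * MvPolynomial.map (algebraMap k' k) (weilComponent α f j) := by
  have hF := isPowFrobenius_natFrobenius hq hk
  obtain ⟨hdeg, hmem⟩ := weilComponent_spec α f
  rw [hq] at hdeg hmem
  have h1 := Ideal.add_mem _ (conjDescent_sub_aeval_mem hF α f) hmem
  rw [sub_add_sub_cancel] at h1
  have h2 := fieldReduce_eq_zero hF.two_le h1
  rw [map_sub, sub_eq_zero] at h2
  rw [h2]
  refine fieldReduce_eq_self hF.two_le fun i => ?_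
  refine (MvPolynomial.degreeOf_sum_le _ _ _).trans (Finset.sup_le fun j _ => ?_)
  refine (MvPolynomial.degreeOf_C_mul_le _ _ _).trans (le_trans ?_ (hdeg j i))
  rw [MvPolynomial.degreeOf_le_iff]
  intro m hm
  exact MvPolynomial.monomial_le_degreeOf i (MvPolynomial.support_map_subset _ _ hm)

theorem totalDegree_weilComponent_le (hq : Nat.card k' = q) (hk : Nat.card k = q ^ n)
    (α : Module.Basis (Fin n) k' k) (f : k[X]) (j : Fin n) :
    (weilComponent α f j).totalDegree ≤ (fakeDescent q n f).totalDegree := by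
  have h := coeffMap_coord_sum α (weilComponent α f) j
  rw [← fieldReduce_conjDescent hq hk] at h
  rw [← h]
  refine (totalDegree_coeffMap_le _ _).trans ((totalDegree_fieldReduce_le _).trans ?_)
  rw [conjDescent_eq_aeval_fakeDescent]
  exact totalDegree_aeval_le (fun j => totalDegree_conjForm_le _ _) _

/-- The ceiling in `fallBound q d` is `c + 1` for some `c` with `d ≤ q ^ c`. -/
theorem exists_fallBound_eq {d : ℕ} (hq : 2 ≤ q) (hd : 0 < d) :
    ∃ c, fallBound q d = (q - 1) * (c + 1) + 1 ∧ d ≤ q ^ c := by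
  have hq1 : (1 : ℝ) < q := by exact_mod_cast hq
  have hd1 : (1 : ℝ) ≤ d := by exact_mod_cast hd
  have hlog : 0 ≤ Real.logb q d := Real.logb_nonneg hq1 hd1
  have hceil : 0 < ⌈Real.logb q d + 1⌉₊ := Nat.ceil_pos.mpr (by linarith)
  refine ⟨⌈Real.logb q d + 1⌉₊ - 1, by rw [fallBound, Nat.sub_add_cancel hceil], ?_⟩
  have h1 : Real.logb q d ≤ ((⌈Real.logb q d + 1⌉₊ - 1 : ℕ) : ℝ) := by
    have := Nat.le_ceil (Real.logb q d + 1)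
    rw [Nat.cast_sub hceil]
    push_cast
    linarith
  rw [Real.logb_le_iff_le_rpow hq1 (by linarith), Real.rpow_natCast] at h1
  exact_mod_cast h1

/-- The bound holds for every positive `d` which bounds the degree of one nonzero `f ∈ F`, and for
which all fake Weil descents of elements of `F` have degree at most `fallBound q d`. -/
theorem lastFallDegree_weilSystemField_le (hq : Nat.card k' = q) (hk : Nat.card k = q ^ n)
    (α : Module.Basis (Fin n) k' k) (F : Set k[X]) {d : ℕ} (hd0 : 0 < d) {f : k[X]} (hfF : f ∈ F)
    (hf0 : f ≠ 0) (hfd : f.natDegree ≤ d)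
    (hdeg : ∀ f ∈ F, (fakeDescent q n f).totalDegree ≤ fallBound q d) :
    lastFallDegree (weilSystemField α F) ≤ (fallBound q d : ℕ∞) := by
  have hFr := isPowFrobenius_natFrobenius hq hk
  have hq2 := hFr.two_le
  have : Finite k := Nat.finite_of_card_ne_zero (by rw [hk]; positivity)
  obtain ⟨c, hB, hdc⟩ := exists_fallBound_eq hq2 hd0
  set E := weilSystemField α F with hE
  have hqB : q ≤ fallBound q d := by
    rw [hB, mul_add, mul_one]; omega
  have hdegE : ∀ v ∈ E, v.totalDegree ≤ fallBound q d := by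
    rintro v (⟨h, hhF, j, rfl⟩ | ⟨j, rfl⟩)
    · exact (totalDegree_weilComponent_le hq hk α h j).trans (hdeg h hhF)
    · refine (MvPolynomial.totalDegree_sub _ _).trans (le_trans ?_ hqB)
      rw [MvPolynomial.totalDegree_X_pow, MvPolynomial.totalDegree_X, hq]
      omega
  refine sInf_le fun g hg => ?_
  obtain ⟨D, hD⟩ : ∃ D, D = max (fallBound q d) g.totalDegree := ⟨_, rfl⟩
  have hBD : fallBound q d ≤ D := hD ▸ le_max_left _ _
  have hgD : g.totalDegree ≤ D := hD ▸ le_max_right _ _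
  suffices hgV : g ∈ fallSpace E D by
    have hmax : max (fallBound q d : ℕ∞) (g.totalDegree : ℕ∞) = (D : ℕ∞) := by
      rw [hD]
      exact (Monotone.map_max fun _ _ h => Nat.cast_le.mpr h).symm
    rw [hmax]
    exact hgV
  have hEV : ∀ v ∈ E, v ∈ fallSpace E D := fun v hv => mem_fallSpace hv ((hdegE v hv).trans hBD)
  set W := extendScalars k (fallSpace E D) with hWdef
  have hW : IsFrobeniusFallSpace (natFrobenius k' k : k →+* k) q D W :=
    isFrobeniusFallSpace_extendScalars _ fun i => hEV _ (Or.inr ⟨i, by rw [hq]⟩)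
  have hc : (q - 1) * (c + 1) + 1 ≤ D := hB ▸ hBD
  have hfW : conjDescent q α f ∈ W := by
    have h1 : (conjDescent q α f).totalDegree ≤ D := by
      rw [conjDescent_eq_aeval_fakeDescent]
      exact (totalDegree_aeval_le (fun j => totalDegree_conjForm_le _ _) _).trans
        ((hdeg f hfF).trans hBD)
    have h2 := hW.sub_fieldReduce_mem hq2 h1
    rw [fieldReduce_conjDescent hq hk] at h2
    refine (W.sub_mem_iff_left (W.sum_mem fun j _ => ?_)).mp h2
    rw [← MvPolynomial.smul_eq_C_mul]
    exact W.smul_mem _ (map_mem_extendScalars_iff.mpr (hEV _ (Or.inl ⟨f, hfF, j, rfl⟩)))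
  obtain ⟨f₀, h₀⟩ := exists_isMinimalDescent hf0 hfW (hfd.trans hdc)
  have hred : ∀ v : MvPolynomial (Fin n) k', v.totalDegree ≤ D →
      MvPolynomial.map (algebraMap k' k) v - conjDescent q α
        (traceSubst q α.traceDual (MvPolynomial.map (algebraMap k' k) v) % f₀) ∈ W := by
    intro v hv
    exact h₀.sub_conjDescent_mem hFr hW hc (X_eq_sum_conjForm hq α)
      ((totalDegree_map_le _ _).trans hv)
  -- by minimality `f₀` divides the images of all elements of the ideal
  have hdvd : Ideal.span E ≤ (Ideal.span {f₀}).comap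
      ((traceSubst q α.traceDual : MvPolynomial (Fin n) k →+* k[X]).comp
        (MvPolynomial.map (algebraMap k' k))) := by
    refine Ideal.span_le.mpr fun v hv => ?_
    refine Ideal.mem_span_singleton.mpr (h₀.dvd ?_)
    exact (W.sub_mem_iff_right (map_mem_extendScalars_iff.mpr (hEV v hv))).mp
      (hred v ((hdegE v hv).trans hBD))
  have hg0 := EuclideanDomain.mod_eq_zero.mpr (Ideal.mem_span_singleton.mp (hdvd hg))
  have h1 := hred g hgD
  rw [RingHom.comp_apply] at hg0
  rw [← map_mem_extendScalars_iff (k := k)]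
  rw [show traceSubst q α.traceDual (MvPolynomial.map (algebraMap k' k) g) % f₀ = 0 from hg0,
    map_zero, sub_zero] at h1
  exact h1

end Main

end WeilDescent

theorem mainTheorem1 {k' k : Type*} [Field k'] [Finite k'] [Field k] [Algebra k' k]
    (q n : ℕ) (hq : Nat.card k' = q) (hk : Nat.card k = q ^ n)
    (α : Module.Basis (Fin n) k' k)
    (F : Finset k[X]) (hF : ∀ f ∈ F, f ∉ Set.range (Polynomial.C : k →+* k[X]))
    (d : ℕ)
    (hd : IsLeast {d : ℕ | 0 < d ∧ (∃ f ∈ F, f.natDegree ≤ d) ∧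
      ∀ f ∈ F, (WeilDescent.fakeDescent q n f).totalDegree ≤ WeilDescent.fallBound q d} d) :
    WeilDescent.lastFallDegree (WeilDescent.weilSystemField α (F : Set k[X])) ≤
      (WeilDescent.fallBound q d : ℕ∞) := by
  obtain ⟨⟨hd0, ⟨f, hfF, hfd⟩, hdeg⟩, -⟩ := hd
  refine WeilDescent.lastFallDegree_weilSystemField_le hq hk α (F : Set k[X]) hd0
    (Finset.mem_coe.mpr hfF) ?_ hfd fun f hf => hdeg f (Finset.mem_coe.mp hf)
  rintro rfl
  exact hF 0 hfF ⟨0, map_zero _⟩
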